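/- Let $d\ge 2$. Alice is given the classical description of an arbitrary pure qubit state with projector $\mathrm P_\psi$. Bob is given one copy of a $d$-level quantum system in an arbitrary pure state $\mathrm P_\phi$, unknown to both parties, and the description of a POVM $\mathrm M=\{\mathrm E^k\}_{k}$ with finitely many outcomes on $\mathbb C^2\otimes\mathbb C^d$, which is not told to Alice. A finite back-and-forth classical protocol consists of a shared random variable $x$ with an arbitrary probability distribution (independent of $\psi,\phi,\mathrm M$) and a finite tree of classical messages between Alice and Bob: there are finitely many rounds, and each message takes finitely many values. Each message of Alice is drawn from a distribution that depends on $x$, $\psi$ and the earlier messages. Each message of Bob is the classical outcome of a quantum instrument on the system he holds at that point, which may depend on $x$, $\mathrm M$ and the earlier messages. At the end Bob performs a POVM on his system, which may depend on $x$, $\mathrm M$ and all messages, and outputs its outcome $k$. The protocol is a generic simulation of a qubit channel $\Lambda$ if for all $\psi$, $\phi$, $\mathrm M$ and $k$ the probability (averaged over $x$ and all messages) that Bob outputs $k$ equals $\operatorname{Tr}[(\Lambda(\mathrm P_\psi)\otimes \mathrm P_\phi)\,\mathrm E^k]$. Then no finite back-and-forth classical protocol is a generic simulation of the perfect qubit channel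 $\Lambda=\mathrm{id}$. -/

import Mathlib

open scoped Kronecker ComplexOrder

noncomputable section

/-- Pure states of an `n`-level system, as rank-one projectors `|v⟩⟨v|` with `v` a unit vector. -/
def PureState (n : ℕ) : Type :=
  {ρ : Matrix (Fin n) (Fin n) ℂ //
    ∃ v : Fin n → ℂ, star v ⬝ᵥ v = 1 ∧ ρ = Matrix.vecMulVec v (star v)}

/-- A measurement (POVM) with `K` outcomes on the system with basis labelled by `ι`. -/
structure Povm (ι : Type) [Fintype ι] [DecidableEq ι] (K : ℕ) where
  effect : Fin K → Matrix ι ι ℂ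
  posSemidef : ∀ b, (effect b).PosSemidef
  sum_eq_one : ∑ b, effect b = 1

/-- The Born rule `Tr[ρ E]`; this trace is real for positive semidefinite `ρ` and `E`. -/
def bornProb {ι : Type} [Fintype ι] (ρ E : Matrix ι ι ℂ) : ℝ :=
  (Matrix.trace (ρ * E)).re

/-- The shape of a finite back-and-forth conversation: a finite tree. At each node either the
conversation is over, or Alice sends one of `k` messages to Bob, or Bob sends one of `k` messages
to Alice, and the conversation goes on in a way that may depend on the message. -/
inductive CommTree : Type
  | done : CommTree
  | alice (k : ℕ) (next : Fin k → CommTree) : CommTree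
  | bob (k : ℕ) (next : Fin k → CommTree) : CommTree

/-- One message of Alice: the distribution of the message, given the value `x` of the shared
random variable and Alice's input `s`. -/
structure AliceMove (Ω : Type*) [MeasurableSpace Ω] (S : Type) (k : ℕ) where
  p : Ω → S → Fin k → ℝ
  nonneg : ∀ x s m, 0 ≤ p x s m
  sum_eq_one : ∀ x s, ∑ m, p x s m = 1
  measurable : ∀ s m, Measurable fun x => p x s m

/-- One message of Bob: given the value `x` of the shared random variable, Bob applies a quantum
instrument to the `d`-level system in his hands. The message `m` is the classical outcome, and the
(unnormalized) state afterwards, of an `e`-level system, is `∑ j, K x m j * ρ * (K x m j)ᴴ`. -/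
structure BobMove (Ω : Type*) [MeasurableSpace Ω] (d e k : ℕ) where
  r : ℕ
  K : Ω → Fin k → Fin r → Matrix (Fin e) (Fin d) ℂ
  complete : ∀ x, ∑ m, ∑ j, (K x m j).conjTranspose * K x m j = 1
  measurable : ∀ m j a b, Measurable fun x => K x m j a b

/-- The (unnormalized) state of Bob's system after he has sent the message `m`. -/
def BobMove.post {Ω : Type*} [MeasurableSpace Ω] {d e k : ℕ} (I : BobMove Ω d e k) (x : Ω)
    (m : Fin k) (ρ : Matrix (Fin d) (Fin d) ℂ) : Matrix (Fin e) (Fin e) ℂ :=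
  ∑ j, I.K x m j * ρ * (I.K x m j).conjTranspose

/-- Bob's measurement at the end of the conversation, which produces the outcome of the
simulation. -/
structure BobFinal (Ω : Type*) [MeasurableSpace Ω] (d K : ℕ) where
  povm : Ω → Povm (Fin d) K
  measurable : ∀ b i j, Measurable fun x => (povm x).effect b i j

/-- Alice's strategy: a move at each node of the tree where she speaks, so that her message depends
on the shared random variable, on her input and on all earlier messages. -/
def AliceStrategy (Ω : Type*) [MeasurableSpace Ω] (S : Type) : CommTree → Type _
  | .done => PUnit
  | .alice k next => AliceMove Ω S k × (∀ m : Fin k, AliceStrategy Ω S (next m))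
  | .bob k next => ∀ m : Fin k, AliceStrategy Ω S (next m)

/-- Bob's strategy when he holds a `d`-level system and has to produce one of `K` outcomes: an
instrument at each node where he speaks, and a final measurement at each leaf. They depend on the
shared random variable and on all earlier messages. The system that Bob holds after an instrument
may have any finite dimension, so that he can use ancillas and keep private records. -/
def BobStrategy (Ω : Type*) [MeasurableSpace Ω] (K : ℕ) : CommTree → ℕ → Type _
  | .done, d => BobFinal Ω d K
  | .alice k next, d => ∀ m : Fin k, BobStrategy Ω K (next m) d
  | .bob k next, d => Σ e : ℕ, BobMove Ω d e k × (∀ m : Fin k, BobStrategy Ω K (next m) e)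

/-- The probability that Bob ends with outcome `b`, when the shared random variable is `x`, Alice's
input is `s` and Bob's system is in state `ρ`. -/
def outcomeProb {Ω : Type*} [MeasurableSpace Ω] {S : Type} {K : ℕ} :
    (T : CommTree) → (d : ℕ) → AliceStrategy Ω S T → BobStrategy Ω K T d →
      Ω → S → Matrix (Fin d) (Fin d) ℂ → Fin K → ℝ
  | .done, _, _, B, x, _, ρ, b => bornProb ρ ((BobFinal.povm B x).effect b)
  | .alice _ next, d, A, B, x, s, ρ, b =>
      ∑ m, A.1.p x s m * outcomeProb (next m) d (A.2 m) (B m) x s ρ b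
  | .bob _ next, _, A, B, x, s, ρ, b =>
      ∑ m, outcomeProb (next m) B.1 (A m) (B.2.2 m) x s (B.2.1.post x m ρ) b

/-- A finite back-and-forth classical protocol for Alice, who is given the classical description of
a pure qubit state, and Bob, who is given a `d`-level system and told which joint measurement on
Alice's qubit and his system is to be simulated (Alice is not told). The shared random variable
takes values in `Ω` with law `μ`. -/
structure ClassicalProtocol (Ω : Type*) [MeasurableSpace Ω] (d : ℕ) where
  μ : MeasureTheory.ProbabilityMeasure Ω
  tree : CommTree
  alice : AliceStrategy Ω (PureState 2) tree
  bob : ∀ K : ℕ, Povm (Fin 2 × Fin d) K → BobStrategy Ω K tree d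

/-- The probability of outcome `b` at Bob's end in the simulation of the measurement `M`, with
Alice's input `ψ` and Bob's system in state `φ`. -/
def ClassicalProtocol.prob {Ω : Type*} [MeasurableSpace Ω] {d : ℕ} (P : ClassicalProtocol Ω d)
    {K : ℕ} (M : Povm (Fin 2 × Fin d) K) (ψ : PureState 2) (φ : PureState d) (b : Fin K) : ℝ :=
  ∫ x, outcomeProb P.tree d P.alice (P.bob K M) x ψ φ.1 b ∂(P.μ : MeasureTheory.Measure Ω)

/-- The protocol is a generic simulation of the qubit channel `Λ`: for every joint measurement
`{E_b}` and all states `ψ`, `φ`, Bob's outcome has the distribution `Tr[(Λ(ψ) ⊗ φ) E_b]`. -/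
def ClassicalProtocol.GenericallySimulates {Ω : Type*} [MeasurableSpace Ω] {d : ℕ}
    (P : ClassicalProtocol Ω d)
    (Λ : Matrix (Fin 2) (Fin 2) ℂ →ₗ[ℂ] Matrix (Fin 2) (Fin 2) ℂ) : Prop :=
  ∀ (K : ℕ) (M : Povm (Fin 2 × Fin d) K) (ψ : PureState 2) (φ : PureState d) (b : Fin K),
    P.prob M ψ φ b = bornProb (Λ ψ.1 ⊗ₖ φ.1) (M.effect b)

/-- The perfect qubit channel: the identity. -/
def perfectQubitChannel : Matrix (Fin 2) (Fin 2) ℂ →ₗ[ℂ] Matrix (Fin 2) (Fin 2) ℂ :=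
  LinearMap.id

end

/-! For fixed shared randomness and measurement, a protocol gives an outcome the probability `∑ l, a
l s * bornProb ρ (E l)` over the transcripts `l` of its tree (`outcomeProb_eq_sum_transcript`):
Alice's weights ignore Bob's state, and Bob's effects ignore Alice's input.

Simulate the test for the maximally entangled state. On equal real unit vectors it succeeds with
probability 1/2, on orthogonal ones never. The zeros force, for almost every `x`, each effect that
Alice's input makes possible to annihilate the vector orthogonal to that input. An effect possible
for two non-parallel inputs then annihilates the whole plane, so each transcript can yield success
on equal vectors for at most one input (`card_outcomeProb_ne_zero_le`). With `N` transcripts and `2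
* N + 1` pairwise non-parallel inputs, the success probabilities sum to at most `N` almost surely,
but to `N + 1/2` on average. -/

/-- The complete transcripts of a conversation. -/
def CommTree.Transcript : CommTree → Type
  | .done => Unit
  | .alice k next => Σ m : Fin k, (next m).Transcript
  | .bob k next => Σ m : Fin k, (next m).Transcript

instance CommTree.fintypeTranscript : (T : CommTree) → Fintype T.Transcript
  | .done => inferInstanceAs (Fintype Unit)
  | .alice k next =>
    letI := fun m => CommTree.fintypeTranscript (next m)
    inferInstanceAs (Fintype (Σ m : Fin k, (next m).Transcript))
  | .bob k next =>
    letI := fun m => CommTree.fintypeTranscript (next m)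
    inferInstanceAs (Fintype (Σ m : Fin k, (next m).Transcript))

/-! ### Born rule -/

theorem bornProb_sum_left {ι κ : Type} [Fintype ι] (s : Finset κ) (ρ : κ → Matrix ι ι ℂ)
    (E : Matrix ι ι ℂ) : bornProb (∑ j ∈ s, ρ j) E = ∑ j ∈ s, bornProb (ρ j) E := by
  simp [bornProb, Finset.sum_mul, Matrix.trace_sum]

theorem bornProb_sum_right {ι κ : Type} [Fintype ι] (s : Finset κ) (ρ : Matrix ι ι ℂ)
    (E : κ → Matrix ι ι ℂ) : bornProb ρ (∑ j ∈ s, E j) = ∑ j ∈ s, bornProb ρ (E j) := by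
  simp [bornProb, Finset.mul_sum, Matrix.trace_sum]

theorem bornProb_conj {d e : ℕ} (K : Matrix (Fin e) (Fin d) ℂ) (ρ : Matrix (Fin d) (Fin d) ℂ)
    (E : Matrix (Fin e) (Fin e) ℂ) :
    bornProb (K * ρ * K.conjTranspose) E = bornProb ρ (K.conjTranspose * E * K) := by
  unfold bornProb
  rw [Matrix.mul_assoc, Matrix.mul_assoc, Matrix.trace_mul_comm]
  simp only [Matrix.mul_assoc]

theorem bornProb_vecMulVec {ι : Type} [Fintype ι] (v : ι → ℂ) (E : Matrix ι ι ℂ) :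
    bornProb (Matrix.vecMulVec v (star v)) E = (star v ⬝ᵥ E.mulVec v).re := by
  unfold bornProb
  rw [Matrix.trace_mul_comm, Matrix.mul_vecMulVec, Matrix.trace_vecMulVec, dotProduct_comm]

theorem bornProb_vecMulVec_nonneg {ι : Type} [Fintype ι] (v : ι → ℂ) {E : Matrix ι ι ℂ}
    (hE : E.PosSemidef) : 0 ≤ bornProb (Matrix.vecMulVec v (star v)) E := by
  rw [bornProb_vecMulVec]
  exact (Complex.le_def.1 (hE.dotProduct_mulVec_nonneg v)).1

theorem mulVec_eq_zero_of_bornProb_eq_zero {ι : Type} [Fintype ι] {v : ι → ℂ}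
    {E : Matrix ι ι ℂ} (hE : E.PosSemidef)
    (h : bornProb (Matrix.vecMulVec v (star v)) E = 0) : E.mulVec v = 0 := by
  rw [bornProb_vecMulVec] at h
  have h0 := Complex.le_def.1 (hE.dotProduct_mulVec_nonneg v)
  exact (hE.dotProduct_mulVec_zero_iff v).1 (Complex.ext h h0.2.symm)

/-! ### Outcome probabilities over transcripts -/

/-- For a fixed value of the shared randomness, the outcome probability is a sum over transcripts
of Alice's weight times the probability of an effect implemented by Bob. -/
theorem outcomeProb_eq_sum_transcript {Ω : Type*} [MeasurableSpace Ω] {S : Type} {K : ℕ}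
    (T : CommTree) : ∀ (d : ℕ) (A : AliceStrategy Ω S T) (B : BobStrategy Ω K T d)
      (x : Ω) (b : Fin K),
      ∃ (a : T.Transcript → S → ℝ) (E : T.Transcript → Matrix (Fin d) (Fin d) ℂ),
        (∀ l s, 0 ≤ a l s) ∧ (∀ l, (E l).PosSemidef) ∧
        ∀ s ρ, outcomeProb T d A B x s ρ b = ∑ l, a l s * bornProb ρ (E l) := by
  induction T with
  | done =>
    intro d A B x b
    refine ⟨fun _ _ => 1, fun _ => (BobFinal.povm B x).effect b, by simp,
      fun _ => (BobFinal.povm B x).posSemidef b, fun s ρ => ?_⟩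
    simp only [one_mul]
    exact (Fintype.sum_unique (ι := Unit) fun _ => bornProb ρ ((BobFinal.povm B x).effect b)).symm
  | alice k next ih =>
    intro d A B x b
    choose a E ha hE h using fun m => ih m d (A.2 m) (B m) x b
    refine ⟨fun l s => A.1.p x s l.1 * a l.1 l.2 s, fun l => E l.1 l.2,
      fun l s => mul_nonneg (A.1.nonneg _ _ _) (ha _ _ _), fun l => hE _ _, fun s ρ => ?_⟩
    refine Eq.trans ?_ (Fintype.sum_sigma (α := fun m => (next m).Transcript) _).symm
    simp only [outcomeProb, h, Finset.mul_sum, mul_assoc]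
  | bob k next ih =>
    intro d A B x b
    choose a E ha hE h using fun m => ih m B.1 (A m) (B.2.2 m) x b
    refine ⟨fun l s => a l.1 l.2 s,
      -- Heisenberg picture: the later effect is pulled back through the Kraus operators of Bob's
      -- message.
      fun l => ∑ j, (B.2.1.K x l.1 j).conjTranspose * E l.1 l.2 * B.2.1.K x l.1 j,
      fun l s => ha _ _ _,
      fun l => Matrix.posSemidef_sum _ fun j _ => (hE _ _).conjTranspose_mul_mul_same _,
      fun s ρ => ?_⟩
    refine Eq.trans ?_ (Fintype.sum_sigma (α := fun m => (next m).Transcript) _).symm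
    simp only [outcomeProb, h, BobMove.post, bornProb_sum_left, bornProb_sum_right, bornProb_conj]

theorem sum_outcomeProb {Ω : Type*} [MeasurableSpace Ω] {S : Type} {K : ℕ}
    (T : CommTree) : ∀ (d : ℕ) (A : AliceStrategy Ω S T) (B : BobStrategy Ω K T d)
      (x : Ω) (s : S) (ρ : Matrix (Fin d) (Fin d) ℂ),
      ∑ b, outcomeProb T d A B x s ρ b = bornProb ρ 1 := by
  induction T with
  | done =>
    intro d A B x s ρ
    simp only [outcomeProb]
    rw [← bornProb_sum_right, (BobFinal.povm B x).sum_eq_one]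
  | alice k next ih =>
    intro d A B x s ρ
    simp only [outcomeProb]
    rw [Finset.sum_comm]
    simp only [← Finset.mul_sum, ih]
    rw [← Finset.sum_mul, A.1.sum_eq_one, one_mul]
  | bob k next ih =>
    intro d A B x s ρ
    simp only [outcomeProb]
    rw [Finset.sum_comm]
    simp only [ih, BobMove.post, bornProb_sum_left, bornProb_conj, Matrix.mul_one]
    simp only [← bornProb_sum_right]
    rw [B.2.1.complete]

/-- The state varies with `x` because Bob's instruments do; the induction needs this generality
after his first message. -/
theorem measurable_outcomeProb {Ω : Type*} [MeasurableSpace Ω] {S : Type} {K : ℕ}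
    (T : CommTree) : ∀ (d : ℕ) (A : AliceStrategy Ω S T) (B : BobStrategy Ω K T d)
      (s : S) (ρ : Ω → Matrix (Fin d) (Fin d) ℂ) (_ : ∀ i j, Measurable fun x => ρ x i j)
      (b : Fin K), Measurable fun x => outcomeProb T d A B x s (ρ x) b := by
  induction T with
  | done =>
    intro d A B s ρ hρ b
    simp only [outcomeProb, bornProb, Matrix.trace, Matrix.diag_apply, Matrix.mul_apply]
    refine Complex.measurable_re.comp ?_
    exact Finset.measurable_fun_sum _ fun i _ => Finset.measurable_fun_sum _ fun j _ =>
      (hρ i j).mul (BobFinal.measurable B b j i)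
  | alice k next ih =>
    intro d A B s ρ hρ b
    simp only [outcomeProb]
    exact Finset.measurable_fun_sum _ fun m _ =>
      (A.1.measurable s m).mul (ih m d (A.2 m) (B m) s ρ hρ b)
  | bob k next ih =>
    intro d A B s ρ hρ b
    simp only [outcomeProb]
    refine Finset.measurable_fun_sum _ fun m _ =>
      ih m B.1 (A m) (B.2.2 m) s (fun x => B.2.1.post x m (ρ x)) (fun i j => ?_) b
    simp only [BobMove.post, Matrix.sum_apply, Matrix.mul_apply, Matrix.conjTranspose_apply]
    exact Finset.measurable_fun_sum _ fun r _ => Finset.measurable_fun_sum _ fun q _ =>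
      (Finset.measurable_fun_sum _ fun p _ => (B.2.1.measurable m r i p).mul (hρ p q)).mul
        (continuous_star.measurable.comp (B.2.1.measurable m r j q))

theorem outcomeProb_pureState_nonneg {Ω : Type*} [MeasurableSpace Ω] {S : Type} {K d : ℕ}
    (T : CommTree) (A : AliceStrategy Ω S T) (B : BobStrategy Ω K T d) (x : Ω) (s : S)
    (φ : PureState d) (b : Fin K) : 0 ≤ outcomeProb T d A B x s φ.1 b := by
  obtain ⟨a, E, ha, hE, h⟩ := outcomeProb_eq_sum_transcript T d A B x b
  obtain ⟨v, -, hv⟩ := φ.2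
  rw [h, hv]
  exact Finset.sum_nonneg fun l _ => mul_nonneg (ha l s) (bornProb_vecMulVec_nonneg v (hE l))

theorem outcomeProb_pureState_le_one {Ω : Type*} [MeasurableSpace Ω] {S : Type} {K d : ℕ}
    (T : CommTree) (A : AliceStrategy Ω S T) (B : BobStrategy Ω K T d) (x : Ω) (s : S)
    (φ : PureState d) (b : Fin K) : outcomeProb T d A B x s φ.1 b ≤ 1 := by
  have h1 : bornProb φ.1 1 = 1 := by
    obtain ⟨v, hv1, hv⟩ := φ.2
    rw [hv, bornProb_vecMulVec, Matrix.one_mulVec, hv1, Complex.one_re]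
  rw [← h1, ← sum_outcomeProb T d A B x s φ.1]
  exact Finset.single_le_sum (f := fun b => outcomeProb T d A B x s φ.1 b)
    (fun b _ => outcomeProb_pureState_nonneg T A B x s φ b) (Finset.mem_univ b)

theorem integrable_outcomeProb_pureState {Ω : Type*} [MeasurableSpace Ω] {S : Type} {K d : ℕ}
    (μ : MeasureTheory.Measure Ω) [MeasureTheory.IsFiniteMeasure μ]
    (T : CommTree) (A : AliceStrategy Ω S T) (B : BobStrategy Ω K T d) (s : S)
    (φ : PureState d) (b : Fin K) :
    MeasureTheory.Integrable (fun x => outcomeProb T d A B x s φ.1 b) μ := by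
  refine MeasureTheory.Integrable.of_bound
    (measurable_outcomeProb T d A B s (fun _ => φ.1) (fun _ _ => measurable_const)
      b).aestronglyMeasurable 1 (Filter.Eventually.of_forall fun x => ?_)
  rw [Real.norm_of_nonneg (outcomeProb_pureState_nonneg T A B x s φ b)]
  exact outcomeProb_pureState_le_one T A B x s φ b

/-- Suppose that for each input `i` the outcome `b` never occurs on the state `w i`, and that
`v i` lies in the span of `w i` and `w j` for all `j ≠ i`. Then each transcript leads to the
outcome `b` on the state `v i` for at most one input `i`. -/
theorem card_outcomeProb_ne_zero_le {Ω : Type*} [MeasurableSpace Ω] {S : Type} {K d : ℕ}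
    (T : CommTree) (A : AliceStrategy Ω S T) (B : BobStrategy Ω K T d) (x : Ω) (b : Fin K)
    {ι : Type} [Fintype ι] (s : ι → S) (v w : ι → Fin d → ℂ)
    (hspan : ∀ i j, i ≠ j → ∃ α β : ℂ, v i = α • w i + β • w j)
    (hw : ∀ i, outcomeProb T d A B x (s i) (Matrix.vecMulVec (w i) (star (w i))) b = 0) :
    (Finset.univ.filter fun i =>
      outcomeProb T d A B x (s i) (Matrix.vecMulVec (v i) (star (v i))) b ≠ 0).card
      ≤ Fintype.card T.Transcript := by
  classical
  obtain ⟨a, E, ha, hE, h⟩ := outcomeProb_eq_sum_transcript T d A B x b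
  simp only [h] at hw ⊢
  have hker : ∀ i l, a l (s i) ≠ 0 → (E l).mulVec (w i) = 0 := by
    intro i l hal
    have h0 := (Finset.sum_eq_zero_iff_of_nonneg fun l _ => mul_nonneg (ha l (s i))
      (bornProb_vecMulVec_nonneg (w i) (hE l))).1 (hw i) l (Finset.mem_univ l)
    exact mulVec_eq_zero_of_bornProb_eq_zero (hE l) ((mul_eq_zero.1 h0).resolve_left hal)
  have hex : ∀ i, ∑ l, a l (s i) * bornProb (Matrix.vecMulVec (v i) (star (v i))) (E l) ≠ 0 →
      ∃ l, a l (s i) ≠ 0 ∧ bornProb (Matrix.vecMulVec (v i) (star (v i))) (E l) ≠ 0 := by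
    intro i hi
    obtain ⟨l, -, hl⟩ := Finset.exists_ne_zero_of_sum_ne_zero hi
    exact ⟨l, left_ne_zero_of_mul hl, right_ne_zero_of_mul hl⟩
  -- Without transcripts every probability is an empty sum; otherwise `choose!` has a default value.
  rcases isEmpty_or_nonempty T.Transcript with hT | hT
  · simp
  choose! f hf1 hf2 using hex
  rw [← Finset.card_univ]
  refine Finset.card_le_card_of_injOn f (fun _ _ => Finset.mem_coe.2 (Finset.mem_univ _)) ?_
  intro i hi j hj hij
  replace hi := (Finset.mem_filter.1 (Finset.mem_coe.1 hi)).2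
  replace hj := (Finset.mem_filter.1 (Finset.mem_coe.1 hj)).2
  by_contra hne
  obtain ⟨α, β, hv⟩ := hspan i j hne
  refine hf2 i hi ?_
  rw [bornProb_vecMulVec]
  -- The transcript shared by `i` and `j` has an effect that annihilates both `w i` and `w j`.
  have : (E (f i)).mulVec (v i) = 0 := by
    rw [hv, Matrix.mulVec_add, Matrix.mulVec_smul, Matrix.mulVec_smul,
      hker i _ (hf1 i hi), hij, hker j _ (hf1 j hj)]
    simp
  rw [this]
  simp

/-! ### Real plane vectors and the Bell test -/

/-- The vector with real coordinates `a`, `b` in the plane of the first two basis vectors. -/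
def planeVec (n : ℕ) (a b : ℝ) : Fin (n + 2) → ℂ :=
  Matrix.vecCons (a : ℂ) (Matrix.vecCons (b : ℂ) 0)

theorem star_planeVec (n : ℕ) (a b : ℝ) : star (planeVec n a b) = planeVec n a b := by
  ext i
  refine Fin.cases ?_ (fun i => Fin.cases ?_ (fun i => ?_) i) i <;> simp [planeVec]

theorem planeVec_dotProduct (n : ℕ) (a b a' b' : ℝ) :
    planeVec n a b ⬝ᵥ planeVec n a' b' = ((a * a' + b * b' : ℝ) : ℂ) := by
  simp [planeVec]

/-- A vector of the plane is a combination of its own rotation by a right angle and of that of any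
vector not parallel to it. -/
theorem exists_planeVec_eq_smul_add_smul (n : ℕ) {a b a' b' : ℝ} (h : a * b' - b * a' ≠ 0) :
    ∃ α β : ℂ, planeVec n a b = α • planeVec n (-b) a + β • planeVec n (-b') a' := by
  have h0 : (a : ℂ) * b' - b * a' ≠ 0 := by exact_mod_cast h
  -- Cramer's rule in the first two coordinates.
  refine ⟨(a * a' + b * b') / (a * b' - b * a'), -(a * a + b * b) / (a * b' - b * a'), ?_⟩
  ext i
  refine Fin.cases ?_ (fun i => Fin.cases ?_ (fun i => ?_) i) i
  · simp only [planeVec, Pi.add_apply, Pi.smul_apply, Matrix.cons_val_zero, smul_eq_mul,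
      Complex.ofReal_neg]
    rw [div_mul_eq_mul_div, div_mul_eq_mul_div, ← add_div, eq_div_iff h0]
    ring
  · simp only [planeVec, Pi.add_apply, Pi.smul_apply, Matrix.cons_val_zero, Matrix.cons_val_succ,
      smul_eq_mul]
    rw [div_mul_eq_mul_div, div_mul_eq_mul_div, ← add_div, eq_div_iff h0]
    ring
  · simp [planeVec]

/-- The pure state of a unit vector with two real coordinates. -/
def planeState (n : ℕ) (a b : ℝ) (h : a * a + b * b = 1) : PureState (n + 2) :=
  ⟨Matrix.vecMulVec (planeVec n a b) (star (planeVec n a b)), planeVec n a b,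
    by rw [star_planeVec, planeVec_dotProduct, h, Complex.ofReal_one], rfl⟩

/-- The unnormalized maximally entangled vector `|00⟩ + |11⟩`. -/
def bellVec (n : ℕ) : Fin 2 × Fin (n + 2) → ℂ :=
  fun p => if p.1 = 0 then planeVec n 1 0 p.2 else planeVec n 0 1 p.2

theorem star_bellVec (n : ℕ) : star (bellVec n) = bellVec n := by
  ext p
  have h1 := congrFun (star_planeVec n 1 0) p.2
  have h2 := congrFun (star_planeVec n 0 1) p.2
  simp only [Pi.star_apply] at h1 h2 ⊢
  unfold bellVec
  split_ifs
  · exact h1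
  · exact h2

theorem bellVec_dotProduct (n : ℕ) (v : Fin 2 → ℂ) (w : Fin (n + 2) → ℂ) :
    (bellVec n ⬝ᵥ fun p => v p.1 * w p.2) = v 0 * w 0 + v 1 * w 1 := by
  simp [dotProduct, bellVec, Fintype.sum_prod_type, Fin.sum_univ_succ, planeVec]

theorem bellVec_dotProduct_self (n : ℕ) : bellVec n ⬝ᵥ bellVec n = 2 := by
  simp [dotProduct, bellVec, Fintype.sum_prod_type, Fin.sum_univ_succ, planeVec]
  norm_num

/-- The projector onto the maximally entangled state. -/
noncomputable def bellProj (n : ℕ) : Matrix (Fin 2 × Fin (n + 2)) (Fin 2 × Fin (n + 2)) ℂ :=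
  (1 / 2 : ℂ) • Matrix.vecMulVec (bellVec n) (star (bellVec n))

theorem bellProj_conjTranspose (n : ℕ) : (bellProj n).conjTranspose = bellProj n := by
  simp [bellProj, Matrix.conjTranspose_smul, Matrix.conjTranspose_vecMulVec]

theorem bellProj_mul_self (n : ℕ) : bellProj n * bellProj n = bellProj n := by
  unfold bellProj
  rw [Matrix.smul_mul, Matrix.mul_smul, Matrix.vecMulVec_mul_vecMulVec, star_bellVec,
    bellVec_dotProduct_self, Matrix.vecMulVec_smul, smul_smul, smul_smul]
  norm_num

/-- The measurement that tests for the maximally entangled state. -/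
noncomputable def bellTest (n : ℕ) : Povm (Fin 2 × Fin (n + 2)) 2 where
  effect := ![bellProj n, 1 - bellProj n]
  posSemidef b := by
    have h0 : (bellProj n).PosSemidef := by
      have := Matrix.posSemidef_conjTranspose_mul_self (bellProj n)
      rwa [bellProj_conjTranspose, bellProj_mul_self] at this
    have h1 : (1 - bellProj n).PosSemidef := by
      have := Matrix.posSemidef_conjTranspose_mul_self (1 - bellProj n)
      rwa [Matrix.conjTranspose_sub, Matrix.conjTranspose_one, bellProj_conjTranspose,
        Matrix.sub_mul, Matrix.mul_sub, Matrix.mul_sub, bellProj_mul_self, Matrix.one_mul,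
        Matrix.mul_one, Matrix.one_mul, sub_self, sub_zero] at this
    fin_cases b
    · exact h0
    · exact h1
  sum_eq_one := by simp

/-- Pairing with the Bell vector is bilinear, without conjugation; for real vectors it is the inner
product. The factor 1/2 normalizes the Bell vector. -/
theorem bornProb_bellTest (n : ℕ) (a b a' b' : ℝ) (h : a * a + b * b = 1)
    (h' : a' * a' + b' * b' = 1) :
    bornProb ((planeState 0 a b h).1 ⊗ₖ (planeState n a' b' h').1) ((bellTest n).effect 0)
      = (a * a' + b * b') ^ 2 / 2 := by
  have hk : (planeState 0 a b h).1 ⊗ₖ (planeState n a' b' h').1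
      = Matrix.vecMulVec (fun p : Fin 2 × Fin (n + 2) => planeVec 0 a b p.1 * planeVec n a' b' p.2)
        (star fun p => planeVec 0 a b p.1 * planeVec n a' b' p.2) := by
    ext p q
    simp [planeState, Matrix.vecMulVec_apply, Matrix.kroneckerMap_apply]
    ring
  have hdot : (bellVec n ⬝ᵥ fun p => planeVec 0 a b p.1 * planeVec n a' b' p.2)
      = ((a * a' + b * b' : ℝ) : ℂ) := by
    rw [bellVec_dotProduct]
    simp [planeVec]
  have hdot' : (star (fun p : Fin 2 × Fin (n + 2) => planeVec 0 a b p.1 * planeVec n a' b' p.2)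
      ⬝ᵥ bellVec n) = ((a * a' + b * b' : ℝ) : ℂ) := by
    rw [Matrix.star_dotProduct, star_bellVec, hdot]
    exact Complex.conj_ofReal _
  rw [hk, bornProb_vecMulVec]
  simp only [bellTest, Matrix.cons_val_zero, bellProj, Matrix.smul_mulVec,
    Matrix.vecMulVec_mulVec, star_bellVec, hdot]
  simp [dotProduct_smul, hdot']
  ring

/-! ### Counting contradiction -/

theorem theorem2 (d : ℕ) (hd : 2 ≤ d) {Ω : Type*} [MeasurableSpace Ω]
    (P : ClassicalProtocol Ω d) : ¬ P.GenericallySimulates perfectQubitChannel := by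
  classical
  intro hP
  obtain ⟨n, rfl⟩ : ∃ n, d = n + 2 := ⟨d - 2, by omega⟩
  set N := Fintype.card P.tree.Transcript with hN
  -- The least number of inputs whose success probabilities 1/2 add up to more than `N`.
  let ι := Fin (2 * N + 1)
  -- Normalizes the vector `(1, i)`; distinct slopes make the inputs pairwise non-parallel.
  let c : ι → ℝ := fun i => 1 / Real.sqrt (1 + (i : ℝ) ^ 2)
  have hc0 : ∀ i, c i ≠ 0 := fun i => by
    have : 0 < Real.sqrt (1 + ((i : ℕ) : ℝ) ^ 2) := Real.sqrt_pos.2 (by positivity)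
    exact one_div_ne_zero this.ne'
  have hc : ∀ i : ι, c i * c i + c i * i * (c i * i) = 1 := fun i => by
    have h1 : c i * c i * (1 + ((i : ℕ) : ℝ) ^ 2) = 1 := by
      have h2 : (0 : ℝ) < 1 + ((i : ℕ) : ℝ) ^ 2 := by positivity
      have h3 := Real.mul_self_sqrt h2.le
      simp only [c]
      rw [div_mul_div_comm, h3]
      field_simp
    linarith
  have hc' : ∀ i : ι, -(c i * i) * -(c i * i) + c i * c i = 1 := fun i => by linarith [hc i]
  let ψ : ι → PureState 2 := fun i => planeState 0 _ _ (hc i)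
  let φ : ι → PureState (n + 2) := fun i => planeState n _ _ (hc i)
  let χ : ι → PureState (n + 2) := fun i => planeState n _ _ (hc' i)
  let q : PureState 2 → PureState (n + 2) → Ω → ℝ := fun s ρ x =>
    outcomeProb P.tree (n + 2) P.alice (P.bob 2 (bellTest n)) x s ρ.1 0
  have hint : ∀ s ρ, MeasureTheory.Integrable (q s ρ) (P.μ : MeasureTheory.Measure Ω) :=
    fun s ρ => integrable_outcomeProb_pureState _ _ _ _ _ _ _
  have hφ : ∀ i, ∫ x, q (ψ i) (φ i) x ∂(P.μ : MeasureTheory.Measure Ω) = 1 / 2 := fun i => by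
    refine (hP 2 (bellTest n) (ψ i) (φ i) 0).trans ((bornProb_bellTest n _ _ _ _ (hc i) (hc i)).trans ?_)
    rw [hc i]
    norm_num
  have hχ : ∀ i, ∫ x, q (ψ i) (χ i) x ∂(P.μ : MeasureTheory.Measure Ω) = 0 := fun i => by
    refine (hP 2 (bellTest n) (ψ i) (χ i) 0).trans ((bornProb_bellTest n _ _ _ _ (hc i) (hc' i)).trans ?_)
    ring
  -- Nonnegative functions with zero integral; the inputs are finitely many, so one null set serves
  -- all.
  have hae : ∀ᵐ x ∂(P.μ : MeasureTheory.Measure Ω), ∀ i, q (ψ i) (χ i) x = 0 :=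
    MeasureTheory.ae_all_iff.2 fun i =>
      (MeasureTheory.integral_eq_zero_iff_of_nonneg
        (fun x => outcomeProb_pureState_nonneg _ _ _ _ _ _ _) (hint _ _)).1 (hχ i)
  have hspan : ∀ i j : ι, i ≠ j → ∃ α β : ℂ, planeVec n (c i) (c i * i) =
      α • planeVec n (-(c i * i)) (c i) + β • planeVec n (-(c j * j)) (c j) := by
    intro i j hij
    refine exists_planeVec_eq_smul_add_smul n ?_
    have hij' : ((j : ℕ) : ℝ) - ((i : ℕ) : ℝ) ≠ 0 :=
      sub_ne_zero.2 fun h => hij (Fin.ext (Nat.cast_injective h).symm)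
    -- The determinant of inputs `i` and `j` is `c i * c j * (j - i)`.
    have := mul_ne_zero (mul_ne_zero (hc0 i) (hc0 j)) hij'
    convert this using 1
    ring
  have hbound : ∀ᵐ x ∂(P.μ : MeasureTheory.Measure Ω), ∑ i, q (ψ i) (φ i) x ≤ N := by
    filter_upwards [hae] with x hx
    have hcard := card_outcomeProb_ne_zero_le P.tree P.alice (P.bob 2 (bellTest n)) x 0 ψ
      (fun i => planeVec n (c i) (c i * i)) (fun i => planeVec n (-(c i * i)) (c i)) hspan hx
    calc ∑ i, q (ψ i) (φ i) x
        = ∑ i ∈ Finset.univ.filter (fun i => q (ψ i) (φ i) x ≠ 0), q (ψ i) (φ i) x :=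
          (Finset.sum_filter_ne_zero _).symm
      _ ≤ ∑ i ∈ Finset.univ.filter (fun i => q (ψ i) (φ i) x ≠ 0), (1 : ℝ) :=
          Finset.sum_le_sum fun i _ => outcomeProb_pureState_le_one _ _ _ _ _ _ _
      _ ≤ N := by
          rw [Finset.sum_const, nsmul_eq_mul, mul_one]
          exact_mod_cast hcard
  have hle := MeasureTheory.integral_mono_ae
    (MeasureTheory.integrable_finsetSum Finset.univ fun i _ => hint (ψ i) (φ i))
    (MeasureTheory.integrable_const (N : ℝ)) hbound
  rw [MeasureTheory.integral_finsetSum _ fun i _ => hint (ψ i) (φ i)] at hle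
  simp only [hφ, Finset.sum_const, Finset.card_univ, MeasureTheory.integral_const,
    MeasureTheory.probReal_univ, one_smul, nsmul_eq_mul, ι, Fintype.card_fin] at hle
  push_cast at hle
  linarith
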